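/- Let $\mathcal C$ be a triangulated category with shift functor $[1]$, and let $(\mathcal X,\mathcal Y)$ be a torsion pair in $\mathcal C$: $\mathcal X,\mathcal Y$ are full additive subcategories closed under isomorphisms and direct summands, $\mathcal C(X,Y)=0$ for all $X\in\mathcal X$, $Y\in\mathcal Y$, and every $C\in\mathcal C$ lies in a distinguished triangle $X\to C\to Y\to X[1]$ with $X\in\mathcal X$, $Y\in\mathcal Y$. Put $\mathcal W=\mathcal X[1]\cap\mathcal Y$. Let $\mathcal C^+$ be the full subcategory of those $C$ for which there is a distinguished triangle $Y\to W\to C\to Y[1]$ with $Y\in\mathcal Y$, $W\in\mathcal W$, and let $\mathcal C^-$ be the full subcategory of those $C$ for which there is a distinguished triangle $X\to C\to W\to X[1]$ with $X\in\mathcal X$, $W\in\mathcal W$. Let $\underline{\mathcal C}=\mathcal C/\mathcal W$ be the quotient of $\mathcal C$ by the ideal of morphisms that factor through an object of $\mathcal W$, and let $\underline{\mathcal C}^{\pm}=\mathcal C^{\pm}/\mathcal W$ and $\underline{\mathcal H}=(\mathcal C^+\cap\mathcal C^-)/\mathcal W$ (the heart) be the corresponding full subcategories of $\underline{\mathcal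 C}$. The inclusion $\underline{\mathcal C}^+\hookrightarrow\underline{\mathcal C}$ has a left adjoint $\tau^+$, the inclusion $\underline{\mathcal C}^-\hookrightarrow\underline{\mathcal C}$ has a right adjoint $\tau^-$, and $\tau^+\tau^-$ takes values in $\underline{\mathcal H}$. Let $H\colon\mathcal C\to\underline{\mathcal H}$ be the composite of the quotient functor $\mathcal C\to\underline{\mathcal C}$ with $\tau^+\tau^-$. Then for every $C\in\mathcal C$ the following are equivalent: 1. $H(C)=0$ in $\underline{\mathcal H}$; 2. for every $X\in\mathcal X$, every morphism $X\to C$ factors through $X_0[1]$ for some $X_0\in\mathcal X$; 3. for every $Y\in\mathcal Y$, every morphism $C\to Y[1]$ factors through some $Y_0\in\mathcal Y$. -/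

import Mathlib

open CategoryTheory CategoryTheory.Limits CategoryTheory.Pretriangulated

universe v u

/-- A torsion pair `(X, Y)` in a triangulated category: two full additive subcategories closed
under isomorphisms and direct summands, such that `Hom(X, Y) = 0` and such that every object `A`
fits in a distinguished triangle `X₀ ⟶ A ⟶ Y₀ ⟶ X₀⟦1⟧` with `X₀ ∈ X` and `Y₀ ∈ Y`. -/
structure TorsionPair (C : Type u) [Category.{v} C] [Preadditive C] [HasZeroObject C]
    [HasShift C ℤ] [∀ n : ℤ, (shiftFunctor C n).Additive] [Pretriangulated C] where
  /-- the torsion class -/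
  X : ObjectProperty C
  /-- the torsionfree class -/
  Y : ObjectProperty C
  zero_X : X.ContainsZero
  zero_Y : Y.ContainsZero
  biprod_X : ∀ A B : C, X A → X B → X (A ⊞ B)
  biprod_Y : ∀ A B : C, Y A → Y B → Y (A ⊞ B)
  retract_X : X.IsStableUnderRetracts
  retract_Y : Y.IsStableUnderRetracts
  hom_eq_zero : ∀ {A B : C}, X A → Y B → ∀ f : A ⟶ B, f = 0
  exists_triangle : ∀ A : C, ∃ (X₀ Y₀ : C) (f : X₀ ⟶ A) (g : A ⟶ Y₀) (h : Y₀ ⟶ X₀⟦(1 : ℤ)⟧),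
    X X₀ ∧ Y Y₀ ∧ Triangle.mk f g h ∈ distTriang C

namespace TorsionPair

variable {C : Type u} [Category.{v} C] [Preadditive C] [HasZeroObject C]
  [HasShift C ℤ] [∀ n : ℤ, (shiftFunctor C n).Additive] [Pretriangulated C]
  (T : TorsionPair C)

attribute [instance] zero_X zero_Y retract_X retract_Y

/-- The subcategory `X[1]`: an object `A` belongs to it when `A⟦-1⟧ ∈ X`. -/
def XShift : ObjectProperty C := T.X.shift (-1 : ℤ)

/-- The subcategory `W = X[1] ∩ Y`. -/
def W : ObjectProperty C := T.XShift ⊓ T.Y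

/-- The subcategory `C⁺`: objects `A` with a distinguished triangle
`Y₀ ⟶ W₀ ⟶ A ⟶ Y₀⟦1⟧`, `Y₀ ∈ Y`, `W₀ ∈ W`. -/
def Plus : ObjectProperty C := fun A =>
  ∃ (Y₀ W₀ : C) (f : Y₀ ⟶ W₀) (g : W₀ ⟶ A) (h : A ⟶ Y₀⟦(1 : ℤ)⟧),
    T.Y Y₀ ∧ T.W W₀ ∧ Triangle.mk f g h ∈ distTriang C

/-- The subcategory `C⁻`: objects `A` with a distinguished triangle
`X₀ ⟶ A ⟶ W₀ ⟶ X₀⟦1⟧`, `X₀ ∈ X`, `W₀ ∈ W`. -/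
def Minus : ObjectProperty C := fun A =>
  ∃ (X₀ W₀ : C) (f : X₀ ⟶ A) (g : A ⟶ W₀) (h : W₀ ⟶ X₀⟦(1 : ℤ)⟧),
    T.X X₀ ∧ T.W W₀ ∧ Triangle.mk f g h ∈ distTriang C

/-- The morphism `f` factors through an object of `W`. -/
def FactorsW {A B : C} (f : A ⟶ B) : Prop :=
  ∃ (W₀ : C) (_ : T.W W₀) (a : A ⟶ W₀) (b : W₀ ⟶ B), a ≫ b = f

/-- The ideal quotient relation: `f ∼ g` when `f - g` factors through an object of `W`. -/
def rel : HomRel C := fun _ _ f g => T.FactorsW (f - g)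

section Orthogonality

lemma yoneda_exact₂ {P Q R D : C} {f : P ⟶ Q} {g : Q ⟶ R} {h : R ⟶ P⟦(1 : ℤ)⟧}
    (hT : Triangle.mk f g h ∈ distTriang C) (x : Q ⟶ D) (hx : f ≫ x = 0) :
    ∃ y : R ⟶ D, x = g ≫ y :=
  Triangle.yoneda_exact₂ _ hT x hx

lemma yoneda_exact₃ {P Q R D : C} {f : P ⟶ Q} {g : Q ⟶ R} {h : R ⟶ P⟦(1 : ℤ)⟧}
    (hT : Triangle.mk f g h ∈ distTriang C) (x : R ⟶ D) (hx : g ≫ x = 0) :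
    ∃ y : P⟦(1 : ℤ)⟧ ⟶ D, x = h ≫ y :=
  Triangle.yoneda_exact₃ _ hT x hx

lemma coyoneda_exact₂ {P Q R D : C} {f : P ⟶ Q} {g : Q ⟶ R} {h : R ⟶ P⟦(1 : ℤ)⟧}
    (hT : Triangle.mk f g h ∈ distTriang C) (x : D ⟶ Q) (hx : x ≫ g = 0) :
    ∃ y : D ⟶ P, x = y ≫ f :=
  Triangle.coyoneda_exact₂ _ hT x hx

lemma coyoneda_exact₃ {P Q R D : C} {f : P ⟶ Q} {g : Q ⟶ R} {h : R ⟶ P⟦(1 : ℤ)⟧}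
    (hT : Triangle.mk f g h ∈ distTriang C) (x : D ⟶ R) (hx : x ≫ h = 0) :
    ∃ y : D ⟶ Q, x = y ≫ g :=
  Triangle.coyoneda_exact₃ _ hT x hx

variable {T}

lemma hom_shift_eq_zero {A B : C} (hA : T.XShift A) (hB : T.Y (B⟦(-1 : ℤ)⟧)) (f : A ⟶ B) :
    f = 0 := by
  apply (shiftFunctor C (-1 : ℤ)).map_injective
  rw [Functor.map_zero]
  exact T.hom_eq_zero hA hB _

lemma XShift_shift {A : C} (hA : T.X A) : T.XShift (A⟦(1 : ℤ)⟧) :=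
  T.X.prop_of_iso ((shiftEquiv C (1 : ℤ)).unitIso.app A) hA

lemma Y_shift {A : C} (hA : T.Y A) : T.Y ((A⟦(1 : ℤ)⟧)⟦(-1 : ℤ)⟧) :=
  T.Y.prop_of_iso ((shiftEquiv C (1 : ℤ)).unitIso.app A) hA

/-- There are no nonzero morphisms from `X[1]` to `Y[1]`. -/
lemma hom_eq_zero' {A B : C} (hA : T.XShift A) (hB : T.Y B) (f : A ⟶ B⟦(1 : ℤ)⟧) : f = 0 :=
  hom_shift_eq_zero hA (Y_shift hB) f

lemma Y_of_orth {B : C} (h : ∀ (A : C), T.X A → ∀ f : A ⟶ B, f = 0) : T.Y B := by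
  obtain ⟨X₀, Y₀, f, g, k, hX, hY, hT⟩ := T.exists_triangle B
  obtain ⟨s, hs⟩ := yoneda_exact₂ hT (𝟙 B) (by rw [h _ hX f, zero_comp])
  exact T.Y.prop_of_retract ⟨g, s, hs.symm⟩ hY

lemma X_of_orth {A : C} (h : ∀ (B : C), T.Y B → ∀ f : A ⟶ B, f = 0) : T.X A := by
  obtain ⟨X₀, Y₀, f, g, k, hX, hY, hT⟩ := T.exists_triangle A
  obtain ⟨s, hs⟩ := coyoneda_exact₂ hT (𝟙 A) (by rw [h _ hY g, comp_zero])
  exact T.X.prop_of_retract ⟨s, f, hs.symm⟩ hX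

lemma XShift_of_orth {A : C} (h : ∀ (B : C), T.Y B → ∀ f : A ⟶ B⟦(1 : ℤ)⟧, f = 0) :
    T.XShift A := by
  refine X_of_orth (fun B hB f => ?_)
  apply (shiftFunctor C (1 : ℤ)).map_injective
  let e : (A⟦(-1 : ℤ)⟧)⟦(1 : ℤ)⟧ ≅ A := (shiftEquiv C (1 : ℤ)).counitIso.app A
  rw [Functor.map_zero, ← cancel_epi e.inv, comp_zero]
  exact h B hB _

/-- Every object `A` fits in a distinguished triangle `Y₀ ⟶ X₁ ⟶ A ⟶ Y₀⟦1⟧` with `Y₀ ∈ Y` and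
`X₁ ∈ X[1]`. -/
lemma exists_triangle' (A : C) : ∃ (Y₀ X₁ : C) (f : Y₀ ⟶ X₁) (g : X₁ ⟶ A)
    (h : A ⟶ Y₀⟦(1 : ℤ)⟧), T.Y Y₀ ∧ T.XShift X₁ ∧ Triangle.mk f g h ∈ distTriang C := by
  obtain ⟨X₀, Y₀, f, g, k, hX, hY, hT⟩ := T.exists_triangle (A⟦(-1 : ℤ)⟧)
  have h2 := rot_of_distTriang _ (rot_of_distTriang _ hT)
  let e : (A⟦(-1 : ℤ)⟧)⟦(1 : ℤ)⟧ ≅ A := (shiftEquiv C (1 : ℤ)).counitIso.app A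
  refine ⟨Y₀, X₀⟦(1 : ℤ)⟧, k, -f⟦(1 : ℤ)⟧' ≫ e.hom, e.inv ≫ (-g⟦(1 : ℤ)⟧'), hY,
    XShift_shift hX, isomorphic_distinguished _ h2 _ ?_⟩
  refine Triangle.isoMk _ _ (Iso.refl Y₀) (Iso.refl (X₀⟦(1 : ℤ)⟧)) e.symm ?_ ?_ ?_
  · change k ≫ 𝟙 _ = 𝟙 _ ≫ k
    simp
  · change (-f⟦(1 : ℤ)⟧' ≫ e.hom) ≫ e.inv = 𝟙 _ ≫ (-f⟦(1 : ℤ)⟧')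
    simp
  · change (e.inv ≫ (-g⟦(1 : ℤ)⟧')) ≫ (𝟙 Y₀)⟦(1 : ℤ)⟧' = e.inv ≫ (-g⟦(1 : ℤ)⟧')
    simp

lemma W_biprod {A B : C} (hA : T.W A) (hB : T.W B) : T.W (A ⊞ B) := by
  refine ⟨XShift_of_orth (fun D hD f => ?_), T.biprod_Y _ _ hA.2 hB.2⟩
  apply biprod.hom_ext' <;> rw [comp_zero]
  · exact hom_eq_zero' hA.1 hD _
  · exact hom_eq_zero' hB.1 hD _

lemma FactorsW.comp_left {A B D : C} {g : B ⟶ D} (hg : T.FactorsW g) (f : A ⟶ B) :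
    T.FactorsW (f ≫ g) := by
  obtain ⟨W₀, hW, a, b, rfl⟩ := hg
  exact ⟨W₀, hW, f ≫ a, b, by simp⟩

lemma FactorsW.comp_right {A B D : C} {f : A ⟶ B} (hf : T.FactorsW f) (g : B ⟶ D) :
    T.FactorsW (f ≫ g) := by
  obtain ⟨W₀, hW, a, b, rfl⟩ := hf
  exact ⟨W₀, hW, a, b ≫ g, by simp⟩

lemma FactorsW.add {A B : C} {f g : A ⟶ B} (hf : T.FactorsW f) (hg : T.FactorsW g) :
    T.FactorsW (f + g) := by
  obtain ⟨W₀, hW, a, b, rfl⟩ := hf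
  obtain ⟨W₁, hW', a', b', rfl⟩ := hg
  exact ⟨W₀ ⊞ W₁, W_biprod hW hW', biprod.lift a a', biprod.desc b b', by simp⟩

lemma FactorsW.neg {A B : C} {f : A ⟶ B} (hf : T.FactorsW f) : T.FactorsW (-f) := by
  obtain ⟨W₀, hW, a, b, rfl⟩ := hf
  exact ⟨W₀, hW, -a, b, by simp⟩

lemma FactorsW.sub {A B : C} {f g : A ⟶ B} (hf : T.FactorsW f) (hg : T.FactorsW g) :
    T.FactorsW (f - g) := by
  rw [sub_eq_add_neg]
  exact hf.add hg.neg

variable (T) in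
lemma factorsW_zero (A B : C) : T.FactorsW (0 : A ⟶ B) := by
  obtain ⟨Z, hZ⟩ := HasZeroObject.zero (C := C)
  refine ⟨Z, ⟨XShift_of_orth fun _ _ f => hZ.eq_of_src _ _,
    Y_of_orth fun _ _ f => hZ.eq_of_tgt _ _⟩, 0, 0, by simp⟩

/-- An object of `C⁺` receives, modulo `W`, no nonzero morphism from `X[1]`. -/
lemma Plus.factorsW {A B : C} (hB : T.Plus B) (hA : T.XShift A) (f : A ⟶ B) :
    T.FactorsW f := by
  obtain ⟨Y₀, W₀, a, b, c, hY, hW, hT⟩ := hB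
  obtain ⟨s, hs⟩ := coyoneda_exact₃ hT f (hom_eq_zero' hA hY _)
  exact ⟨W₀, hW, s, b, hs.symm⟩

/-- An object of `C⁻` has, modulo `W`, no nonzero morphism to `Y`. -/
lemma Minus.factorsW {A B : C} (hA : T.Minus A) (hB : T.Y B) (f : A ⟶ B) :
    T.FactorsW f := by
  obtain ⟨X₀, W₀, a, b, c, hX, hW, hT⟩ := hA
  obtain ⟨s, hs⟩ := yoneda_exact₂ hT f (T.hom_eq_zero hX hB _)
  exact ⟨W₀, hW, b, s, hs.symm⟩

lemma plus_of_factorsW {B : C} (h : ∀ (A : C), T.XShift A → ∀ f : A ⟶ B, T.FactorsW f) :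
    T.Plus B := by
  obtain ⟨Y₀, X₁, f, g, k, hY, hX, hT⟩ := exists_triangle' (T := T) B
  refine ⟨Y₀, X₁, f, g, k, hY, ⟨hX, Y_of_orth fun A hA x => ?_⟩, hT⟩
  obtain ⟨W₀, hW, a, b, hab⟩ := h X₁ hX g
  obtain ⟨s, hs⟩ := coyoneda_exact₃ hT b (hom_eq_zero' hW.1 hY _)
  obtain ⟨t, ht⟩ := coyoneda_exact₂ hT (𝟙 X₁ - a ≫ s) (by
    rw [Preadditive.sub_comp, Category.assoc, ← hs, hab, Category.id_comp, sub_self])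
  have h1 : x ≫ a = 0 := T.hom_eq_zero hA hW.2 _
  have h2 : x ≫ t = 0 := T.hom_eq_zero hA hY _
  have h3 : x ≫ (𝟙 X₁ - a ≫ s) = 0 := by rw [ht, reassoc_of% h2, zero_comp]
  rwa [Preadditive.comp_sub, reassoc_of% h1, zero_comp, sub_zero, Category.comp_id] at h3

lemma minus_of_factorsW {A : C} (h : ∀ (B : C), T.Y B → ∀ f : A ⟶ B, T.FactorsW f) :
    T.Minus A := by
  obtain ⟨X₀, Y₁, f, g, k, hX, hY, hT⟩ := T.exists_triangle A
  refine ⟨X₀, Y₁, f, g, k, hX, ⟨XShift_of_orth fun B hB y => ?_, hY⟩, hT⟩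
  obtain ⟨W₀, hW, a, b, hab⟩ := h Y₁ hY g
  obtain ⟨s, hs⟩ := yoneda_exact₂ hT a (T.hom_eq_zero hX hW.2 _)
  obtain ⟨t, ht⟩ := yoneda_exact₃ hT (𝟙 Y₁ - s ≫ b) (by
    rw [Preadditive.comp_sub, ← Category.assoc, ← hs, hab, Category.comp_id, sub_self])
  have h1 : b ≫ y = 0 := hom_eq_zero' hW.1 hB _
  have h2 : t ≫ y = 0 := hom_eq_zero' (XShift_shift hX) hB _
  have h3 : (𝟙 Y₁ - s ≫ b) ≫ y = 0 := by rw [ht, Category.assoc, h2, comp_zero]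
  rwa [Preadditive.sub_comp, Category.assoc, h1, comp_zero, sub_zero, Category.id_comp] at h3

lemma plus_of_Y {B : C} (hB : T.Y B) : T.Plus B := by
  obtain ⟨Y₀, X₁, f, g, k, hY, hX, hT⟩ := exists_triangle' (T := T) B
  refine ⟨Y₀, X₁, f, g, k, hY, ⟨hX, Y_of_orth fun A hA x => ?_⟩, hT⟩
  obtain ⟨t, ht⟩ := coyoneda_exact₂ hT x (T.hom_eq_zero hA hB _)
  rw [ht, T.hom_eq_zero hA hY t, zero_comp]

lemma minus_of_XShift {A : C} (hA : T.XShift A) : T.Minus A := by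
  obtain ⟨X₀, Y₁, f, g, k, hX, hY, hT⟩ := T.exists_triangle A
  refine ⟨X₀, Y₁, f, g, k, hX, ⟨XShift_of_orth fun B hB y => ?_, hY⟩, hT⟩
  obtain ⟨t, ht⟩ := yoneda_exact₃ hT y (hom_eq_zero' hA hB _)
  rw [ht, hom_eq_zero' (XShift_shift hX) hB t, comp_zero]

end Orthogonality

instance : Congruence T.rel where
  comp_left f g g' h := by
    have := FactorsW.comp_left h f
    rwa [Preadditive.comp_sub] at this
  comp_right g h := by
    have := FactorsW.comp_right h g
    rwa [Preadditive.sub_comp] at this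
  equivalence :=
    { refl := fun f => by
        change T.FactorsW (f - f)
        rw [sub_self]
        exact T.factorsW_zero _ _
      symm := fun {f g} h => by
        have := FactorsW.neg h
        rwa [neg_sub] at this
      trans := fun {f g k} h h' => by
        have := FactorsW.add h h'
        rwa [sub_add_sub_cancel] at this }

/-- The ideal quotient `C/W`. -/
abbrev Quot : Type u := CategoryTheory.Quotient T.rel

/-- The quotient functor `C ⥤ C/W`. -/
abbrev quot : C ⥤ T.Quot := CategoryTheory.Quotient.functor T.rel

/-- The full subcategory `C⁺/W` of `C/W`. -/
def PlusQ : ObjectProperty T.Quot := fun A => T.Plus A.as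

/-- The full subcategory `C⁻/W` of `C/W`. -/
def MinusQ : ObjectProperty T.Quot := fun A => T.Minus A.as

/-- The heart `(C⁺ ∩ C⁻)/W`, a full subcategory of `C/W`. -/
abbrev Heart : Type u := (T.PlusQ ⊓ T.MinusQ).FullSubcategory

section Reflections

variable {T}

lemma quot_map_eq_iff {A B : C} (f g : A ⟶ B) :
    T.quot.map f = T.quot.map g ↔ T.FactorsW (f - g) :=
  CategoryTheory.Quotient.functor_map_eq_iff T.rel f g

lemma factorsW_iff {A B : C} (f : A ⟶ B) :
    T.FactorsW f ↔ T.quot.map f = T.quot.map 0 := by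
  rw [quot_map_eq_iff, sub_zero]

instance : T.MinusQ.IsClosedUnderIsomorphisms where
  of_iso {A B} e hA := by
    refine minus_of_factorsW fun D hD f => ?_
    obtain ⟨i, hi⟩ := T.quot.map_surjective (X := A.as) (Y := B.as) e.hom
    obtain ⟨j, hj⟩ := T.quot.map_surjective (X := B.as) (Y := A.as) e.inv
    have h1 : T.FactorsW (𝟙 B.as - j ≫ i) := by
      rw [← quot_map_eq_iff, Functor.map_comp, hi, hj, e.inv_hom_id]
      exact T.quot.map_id _
    have h2 := (Minus.factorsW hA hD (i ≫ f)).comp_left j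
    have h3 := (h1.comp_right f).add h2
    simpa using h3

instance : T.PlusQ.IsClosedUnderIsomorphisms where
  of_iso {A B} e hA := by
    refine plus_of_factorsW fun D hD f => ?_
    obtain ⟨i, hi⟩ := T.quot.map_surjective (X := A.as) (Y := B.as) e.hom
    obtain ⟨j, hj⟩ := T.quot.map_surjective (X := B.as) (Y := A.as) e.inv
    have h1 : T.FactorsW (𝟙 B.as - j ≫ i) := by
      rw [← quot_map_eq_iff, Functor.map_comp, hi, hj, e.inv_hom_id]
      exact T.quot.map_id _
    have h2 := (Plus.factorsW hA hD (f ≫ j)).comp_right i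
    have h3 := (h1.comp_left f).add h2
    simpa using h3

/-- Existence of a reflection triangle. -/
lemma exists_reflection [IsTriangulated C] (T : TorsionPair C) (A : C) :
    ∃ (X' X₁ Z : C) (p : X' ⟶ X₁) (q : X₁ ⟶ A) (z : A ⟶ Z) (h : Z ⟶ X'⟦(1 : ℤ)⟧),
      T.X X' ∧ T.XShift X₁ ∧ T.Plus Z ∧ Triangle.mk (p ≫ q) z h ∈ distTriang C := by
  obtain ⟨Y₀, X₁, _, q, k, hY, hX, hT⟩ := exists_triangle' (T := T) A
  obtain ⟨X', W₀, p, b, c, hX', hW, hT'⟩ := minus_of_XShift hX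
  obtain ⟨Z, z, h, hZ⟩ := distinguished_cocone_triangle (p ≫ q)
  have o := (Triangulated.someOctahedron rfl hT' (rot_of_distTriang _ hT) hZ).mem
  refine ⟨X', X₁, Z, p, q, z, h, hX', hX, ?_, hZ⟩
  refine plus_of_factorsW fun D hD f => ?_
  obtain ⟨t, ht⟩ := coyoneda_exact₂ o f (hom_eq_zero' hD hY _)
  exact ⟨W₀, hW, t, _, ht.symm⟩

/-- Existence of a coreflection triangle. -/
lemma exists_coreflection [IsTriangulated C] (T : TorsionPair C) (A : C) :
    ∃ (Y' Y₁ K : C) (j : Y' ⟶ K) (k : K ⟶ A) (q : A ⟶ Y₁) (p : Y₁ ⟶ Y'⟦(1 : ℤ)⟧),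
      T.Y Y' ∧ T.Y Y₁ ∧ T.Minus K ∧ Triangle.mk j k (q ≫ p) ∈ distTriang C := by
  obtain ⟨X₀, Y₁, a, q, c, hX, hY, hT⟩ := T.exists_triangle A
  obtain ⟨Y', W₀, b, d, p, hY', hW, hT'⟩ := plus_of_Y hY
  obtain ⟨K, j, k, hK⟩ := distinguished_cocone_triangle₂ (q ≫ p)
  have o := (Triangulated.someOctahedron' rfl hT (rot_of_distTriang _ hT') (rot_of_distTriang _ hK)).mem
  refine ⟨Y', Y₁, K, j, k, q, p, hY', hY, ?_, hK⟩
  refine minus_of_factorsW fun D hD f => ?_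
  obtain ⟨t, ht⟩ := yoneda_exact₂ o f (T.hom_eq_zero hX hD _)
  exact ⟨W₀, hW, _, t, ht.symm⟩

/-- The universal property of a reflection triangle. -/
lemma reflection_bijective {A X' X₁ Z : C} {p : X' ⟶ X₁} {q : X₁ ⟶ A} {z : A ⟶ Z}
    {h : Z ⟶ X'⟦(1 : ℤ)⟧} (hX' : T.X X') (hX₁ : T.XShift X₁)
    (hT : Triangle.mk (p ≫ q) z h ∈ distTriang C) {B : C} (hB : T.Plus B) :
    Function.Bijective (fun g : T.quot.obj Z ⟶ T.quot.obj B => T.quot.map z ≫ g) := by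
  constructor
  · intro g g' hg
    obtain ⟨g, rfl⟩ := T.quot.map_surjective g
    obtain ⟨g', rfl⟩ := T.quot.map_surjective g'
    dsimp only at hg
    rw [← Functor.map_comp, ← Functor.map_comp, quot_map_eq_iff, ← Preadditive.comp_sub] at hg
    rw [quot_map_eq_iff]
    obtain ⟨W₀, hW, a, b, hab⟩ := hg
    obtain ⟨s, hs⟩ := yoneda_exact₂ hT a (T.hom_eq_zero hX' hW.2 _)
    obtain ⟨t, ht⟩ := yoneda_exact₃ hT (g - g' - s ≫ b) (by
      rw [Preadditive.comp_sub, ← Category.assoc, ← hs, hab, sub_self])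
    have h1 : T.FactorsW (h ≫ t) := (Plus.factorsW hB (XShift_shift hX') t).comp_left h
    have h2 : T.FactorsW (s ≫ b) := ⟨W₀, hW, s, b, rfl⟩
    have h3 := h1.add h2
    rwa [← ht, sub_add_cancel] at h3
  · intro f
    obtain ⟨f, rfl⟩ := T.quot.map_surjective f
    obtain ⟨W₀, hW, a, b, hab⟩ := Plus.factorsW hB hX₁ (q ≫ f)
    obtain ⟨s, hs⟩ := yoneda_exact₂ hT f (by
      rw [Category.assoc, ← hab, ← Category.assoc, T.hom_eq_zero hX' hW.2 (p ≫ a), zero_comp])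
    exact ⟨T.quot.map s, by dsimp only; rw [← Functor.map_comp, hs]⟩

/-- The universal property of a coreflection triangle. -/
lemma coreflection_bijective {A Y' Y₁ K : C} {j : Y' ⟶ K} {k : K ⟶ A} {q : A ⟶ Y₁}
    {p : Y₁ ⟶ Y'⟦(1 : ℤ)⟧} (hY' : T.Y Y') (hY₁ : T.Y Y₁)
    (hT : Triangle.mk j k (q ≫ p) ∈ distTriang C) {B : C} (hB : T.Minus B) :
    Function.Bijective (fun g : T.quot.obj B ⟶ T.quot.obj K => g ≫ T.quot.map k) := by
  constructor
  · intro g g' hg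
    obtain ⟨g, rfl⟩ := T.quot.map_surjective g
    obtain ⟨g', rfl⟩ := T.quot.map_surjective g'
    dsimp only at hg
    rw [← Functor.map_comp, ← Functor.map_comp, quot_map_eq_iff, ← Preadditive.sub_comp] at hg
    rw [quot_map_eq_iff]
    obtain ⟨W₀, hW, a, b, hab⟩ := hg
    obtain ⟨s, hs⟩ := coyoneda_exact₃ hT b (hom_eq_zero' hW.1 hY' _)
    obtain ⟨t, ht⟩ := coyoneda_exact₂ hT (g - g' - a ≫ s) (by
      rw [Preadditive.sub_comp, Category.assoc, ← hs, hab, sub_self])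
    have h1 : T.FactorsW (t ≫ j) := (Minus.factorsW hB hY' t).comp_right j
    have h2 : T.FactorsW (a ≫ s) := ⟨W₀, hW, a, s, rfl⟩
    have h3 := h1.add h2
    rwa [← ht, sub_add_cancel] at h3
  · intro f
    obtain ⟨f, rfl⟩ := T.quot.map_surjective f
    obtain ⟨W₀, hW, a, b, hab⟩ := Minus.factorsW hB hY₁ (f ≫ q)
    obtain ⟨s, hs⟩ := coyoneda_exact₃ hT f (by
      rw [← Category.assoc, ← hab, Category.assoc, hom_eq_zero' hW.1 hY' (b ≫ p), comp_zero])
    exact ⟨T.quot.map s, by dsimp only; rw [← Functor.map_comp, hs]⟩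

/-- A reflection triangle for `A` gives a universal arrow from `A` to `C⁺/W`. -/
noncomputable def reflectionIsInitial {A X' X₁ Z : C} {p : X' ⟶ X₁} {q : X₁ ⟶ A} {z : A ⟶ Z}
    {h : Z ⟶ X'⟦(1 : ℤ)⟧} (hX' : T.X X') (hX₁ : T.XShift X₁) (hZ : T.Plus Z)
    (hT : Triangle.mk (p ≫ q) z h ∈ distTriang C) :
    IsInitial (StructuredArrow.mk (S := T.quot.obj A) (T := T.PlusQ.ι)
      (Y := ⟨T.quot.obj Z, hZ⟩) (T.quot.map z)) :=
  IsInitial.ofUniqueHom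
    (fun D => StructuredArrow.homMk
      (ObjectProperty.homMk ((reflection_bijective hX' hX₁ hT D.right.property).2 D.hom).choose)
      ((reflection_bijective hX' hX₁ hT D.right.property).2 D.hom).choose_spec)
    (fun D m => by
      ext
      apply (reflection_bijective hX' hX₁ hT D.right.property).1
      exact (StructuredArrow.w m).trans
        ((reflection_bijective hX' hX₁ hT D.right.property).2 D.hom).choose_spec.symm)

/-- A coreflection triangle for `A` gives a universal arrow from `C⁻/W` to `A`. -/
noncomputable def coreflectionIsTerminal {A Y' Y₁ K : C} {j : Y' ⟶ K} {k : K ⟶ A} {q : A ⟶ Y₁}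
    {p : Y₁ ⟶ Y'⟦(1 : ℤ)⟧} (hY' : T.Y Y') (hY₁ : T.Y Y₁) (hK : T.Minus K)
    (hT : Triangle.mk j k (q ≫ p) ∈ distTriang C) :
    IsTerminal (CostructuredArrow.mk (T := T.quot.obj A) (S := T.MinusQ.ι)
      (Y := ⟨T.quot.obj K, hK⟩) (T.quot.map k)) :=
  IsTerminal.ofUniqueHom
    (fun D => CostructuredArrow.homMk
      (ObjectProperty.homMk ((coreflection_bijective hY' hY₁ hT D.left.property).2 D.hom).choose)
      ((coreflection_bijective hY' hY₁ hT D.left.property).2 D.hom).choose_spec)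
    (fun D m => by
      ext
      apply (coreflection_bijective hY' hY₁ hT D.left.property).1
      exact (CostructuredArrow.w m).trans
        ((coreflection_bijective hY' hY₁ hT D.left.property).2 D.hom).choose_spec.symm)

instance isRightAdjoint_plus [IsTriangulated C] : T.PlusQ.ι.IsRightAdjoint := by
  have : ∀ A, HasInitial (StructuredArrow A T.PlusQ.ι) := fun A => by
    obtain ⟨X', X₁, Z, p, q, z, h, hX', hX₁, hZ, hT⟩ := exists_reflection T A.as
    exact (reflectionIsInitial hX' hX₁ hZ hT).hasInitial
  exact isRightAdjointOfStructuredArrowInitials _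

instance isLeftAdjoint_minus [IsTriangulated C] : T.MinusQ.ι.IsLeftAdjoint := by
  have : ∀ A, HasTerminal (CostructuredArrow T.MinusQ.ι A) := fun A => by
    obtain ⟨Y', Y₁, K, j, k, q, p, hY', hY₁, hK, hT⟩ := exists_coreflection T A.as
    exact (coreflectionIsTerminal hY' hY₁ hK hT).hasTerminal
  exact isLeftAdjoint_of_costructuredArrowTerminals _

end Reflections

variable [IsTriangulated C]

/-- `τ⁺ : C/W ⥤ C⁺/W`, the left adjoint of the inclusion. -/
noncomputable def tauPlus : T.Quot ⥤ T.PlusQ.FullSubcategory := T.PlusQ.ι.leftAdjoint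

/-- The adjunction between `τ⁺` and the inclusion. -/
noncomputable def tauPlusAdj : T.tauPlus ⊣ T.PlusQ.ι := Adjunction.ofIsRightAdjoint _

/-- `τ⁻ : C/W ⥤ C⁻/W`, the right adjoint of the inclusion. -/
noncomputable def tauMinus : T.Quot ⥤ T.MinusQ.FullSubcategory := T.MinusQ.ι.rightAdjoint

/-- The adjunction between the inclusion and `τ⁻`. -/
noncomputable def tauMinusAdj : T.MinusQ.ι ⊣ T.tauMinus := Adjunction.ofIsLeftAdjoint _

/-- The endofunctor `τ⁺τ⁻` of `C/W`. -/
noncomputable def tau : T.Quot ⥤ T.Quot :=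
  T.tauMinus ⋙ T.MinusQ.ι ⋙ T.tauPlus ⋙ T.PlusQ.ι

/-- The functor `τ⁺` preserves `C⁻/W`. -/
lemma tauPlus_minusQ (A : T.Quot) (hA : T.MinusQ A) : T.MinusQ (T.tauPlus.obj A).obj := by
  obtain ⟨X', X₁, Z, p, q, z, h, hX', hX₁, hZ, hT⟩ := exists_reflection T A.as
  have hZ' : T.Minus Z := by
    refine minus_of_factorsW fun D hD f => ?_
    obtain ⟨W₀, hW, a, b, hab⟩ := Minus.factorsW hA hD (z ≫ f)
    obtain ⟨s, hs⟩ := yoneda_exact₂ hT a (T.hom_eq_zero hX' hW.2 _)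
    obtain ⟨t, ht⟩ := yoneda_exact₃ hT (f - s ≫ b) (by
      rw [Preadditive.comp_sub, ← Category.assoc, ← hs, hab, sub_self])
    have h1 : T.FactorsW (h ≫ t) :=
      (Plus.factorsW (plus_of_Y hD) (XShift_shift hX') t).comp_left h
    have h2 : T.FactorsW (s ≫ b) := ⟨W₀, hW, s, b, rfl⟩
    have h3 := h1.add h2
    rwa [← ht, sub_add_cancel] at h3
  let e := (mkInitialOfLeftAdjoint _ T.tauPlusAdj A).uniqueUpToIso
    (reflectionIsInitial hX' hX₁ hZ hT)
  let e' : (T.tauPlus.obj A).obj ≅ T.quot.obj Z :=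
    T.PlusQ.ι.mapIso ((StructuredArrow.proj _ _).mapIso e)
  exact T.MinusQ.prop_of_iso e'.symm hZ'

/-- The functor `H : C ⥤ Heart`, that is, `τ⁺τ⁻` precomposed with the quotient functor and viewed
as a functor to the heart. -/
noncomputable def H : C ⥤ T.Heart :=
  ObjectProperty.lift (T.PlusQ ⊓ T.MinusQ) (T.quot ⋙ T.tau) (fun A =>
    ⟨(T.tauPlus.obj (T.tauMinus.obj (T.quot.obj A)).obj).property,
      T.tauPlus_minusQ _ (T.tauMinus.obj (T.quot.obj A)).property⟩)

end TorsionPair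

/-!
Choose a coreflection triangle `Y' ⟶ K ⟶ A ⟶ Y'⟦1⟧`, with `K` in `C⁻` representing `τ⁻ A`, and a
reflection triangle `X' ⟶ K ⟶ Z ⟶ X'⟦1⟧`, with `Z` in `C⁺` representing `τ⁺ K`, whose first map
factors through an object of `X[1]`. Then `H A` is represented by `Z`, and by the universal property
of `z : K ⟶ Z` it vanishes exactly when `z` factors through `W` (`isZero_H_iff`).

If it does, a map from `X₀ ∈ X` to `A` lifts to `K`, the lift is killed by `z` because
`Hom(X, W) = 0`, and so it factors through the `X[1]`-object of the reflection triangle.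
Conversely, `K` sits in a triangle `X₀ ⟶ K ⟶ W₀ ⟶ X₀⟦1⟧`, and `z` factors through `W₀` as soon as
`X₀ ⟶ K ⟶ Z` is zero. If `X₀ ⟶ K ⟶ A` factors through `X[1]`, then so does `X₀ ⟶ K`, because maps
from `X[1] ⊆ C⁻` to `A` lift to `K` modulo `W`; the composite to `Z` vanishes because maps from
`X[1]` to `C⁺` factor through `W`.

The equivalence of the two factorization conditions is separate from this and only compares the
triangles `Y ⟶ X₁ ⟶ A ⟶ Y⟦1⟧` and `X ⟶ A ⟶ Y₁ ⟶ X⟦1⟧` given by the torsion pair, using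
`Hom(X, Y) = 0` and `Hom(X[1], Y[1]) = 0`.
-/

namespace TorsionPair

variable {C : Type u} [Category.{v} C] [Preadditive C] [HasZeroObject C]
  [HasShift C ℤ] [∀ n : ℤ, (shiftFunctor C n).Additive] [Pretriangulated C]
  {T : TorsionPair C}

lemma XShift.exists_iso_shift {A : C} (hA : T.XShift A) :
    ∃ X₀ : C, T.X X₀ ∧ Nonempty (X₀⟦(1 : ℤ)⟧ ≅ A) :=
  ⟨A⟦(-1 : ℤ)⟧, hA, ⟨(shiftEquiv C (1 : ℤ)).counitIso.app A⟩⟩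

lemma FactorsW.comp_eq_zero_of_X {X₀ A B : C} {f : A ⟶ B} (hf : T.FactorsW f) (hX : T.X X₀)
    (x : X₀ ⟶ A) : x ≫ f = 0 := by
  obtain ⟨W₀, hW, a, b, rfl⟩ := hf
  rw [← Category.assoc, T.hom_eq_zero hX hW.2 (x ≫ a), zero_comp]

lemma FactorsW.id_of_iso {A B : C} (e : T.quot.obj A ≅ T.quot.obj B)
    (hB : T.FactorsW (𝟙 B)) : T.FactorsW (𝟙 A) := by
  obtain ⟨i, hi⟩ := T.quot.map_surjective e.hom
  obtain ⟨j, hj⟩ := T.quot.map_surjective e.inv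
  have h1 : T.FactorsW (𝟙 A - i ≫ j) := by
    rw [← quot_map_eq_iff, Functor.map_comp, hi, hj, e.hom_inv_id]
    exact T.quot.map_id _
  have h2 : T.FactorsW (i ≫ j) := by
    simpa using (hB.comp_left i).comp_right j
  simpa using h1.add h2

lemma FactorsW.of_id_right {A B : C} (hB : T.FactorsW (𝟙 B)) (f : A ⟶ B) : T.FactorsW f := by
  simpa using hB.comp_left f

lemma FactorsW.of_id_left {A B : C} (hA : T.FactorsW (𝟙 A)) (f : A ⟶ B) : T.FactorsW f := by
  simpa using hA.comp_right f

/-- `C/W` carries no chosen zero morphisms, so the vanishing of an object is expressed by its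
identity factoring through `W`. -/
lemma isZero_heart_iff (M : T.Heart) : IsZero M ↔ T.FactorsW (𝟙 M.obj.as) := by
  constructor
  · intro h
    have h1 : 𝟙 M = ObjectProperty.homMk (T.quot.map (X := M.obj.as) (Y := M.obj.as) 0) :=
      h.eq_of_src _ _
    rw [factorsW_iff]
    exact (T.quot.map_id _).trans (congrArg (fun f : M ⟶ M => f.hom) h1)
  · intro h
    refine ⟨fun N => ⟨⟨⟨ObjectProperty.homMk (T.quot.map (X := M.obj.as) (Y := N.obj.as) 0)⟩,
      fun f => ?_⟩⟩, fun N => ⟨⟨⟨ObjectProperty.homMk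
        (T.quot.map (X := N.obj.as) (Y := M.obj.as) 0)⟩, fun f => ?_⟩⟩⟩
    · ext
      obtain ⟨g, hg⟩ := T.quot.map_surjective (X := M.obj.as) (Y := N.obj.as) f.hom
      exact hg.symm.trans ((factorsW_iff g).1 (h.of_id_left g))
    · ext
      obtain ⟨g, hg⟩ := T.quot.map_surjective (X := N.obj.as) (Y := M.obj.as) f.hom
      exact hg.symm.trans ((factorsW_iff g).1 (h.of_id_right g))

/-- The target of a reflection vanishes in `C/W` exactly when the reflection map does. -/
lemma factorsW_id_iff_reflection {A X' X₁ Z : C} {p : X' ⟶ X₁} {q : X₁ ⟶ A} {z : A ⟶ Z}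
    {h : Z ⟶ X'⟦(1 : ℤ)⟧} (hX' : T.X X') (hX₁ : T.XShift X₁) (hZ : T.Plus Z)
    (hT : Triangle.mk (p ≫ q) z h ∈ distTriang C) :
    T.FactorsW (𝟙 Z) ↔ T.FactorsW z := by
  refine ⟨fun hid => hid.of_id_right z, fun hz => ?_⟩
  rw [factorsW_iff]
  apply (reflection_bijective hX' hX₁ hT hZ).1
  dsimp only
  rw [← Functor.map_comp, ← Functor.map_comp, Category.comp_id, comp_zero]
  exact (factorsW_iff z).1 hz

/-- `H A` can be computed from any coreflection triangle of `A` followed by any reflection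
triangle of the coreflection. -/
lemma isZero_H_iff [IsTriangulated C] {A Y' Y₁ K : C} {j : Y' ⟶ K} {k : K ⟶ A} {r : A ⟶ Y₁}
    {s : Y₁ ⟶ Y'⟦(1 : ℤ)⟧} (hY' : T.Y Y') (hY₁ : T.Y Y₁) (hK : T.Minus K)
    (hTK : Triangle.mk j k (r ≫ s) ∈ distTriang C)
    {X' X₁ Z : C} {p : X' ⟶ X₁} {q : X₁ ⟶ K} {z : K ⟶ Z}
    {h : Z ⟶ X'⟦(1 : ℤ)⟧} (hX' : T.X X') (hX₁ : T.XShift X₁) (hZ : T.Plus Z)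
    (hTZ : Triangle.mk (p ≫ q) z h ∈ distTriang C) :
    IsZero (T.H.obj A) ↔ T.FactorsW z := by
  let eK : (T.tauMinus.obj (T.quot.obj A)).obj ≅ T.quot.obj K :=
    T.MinusQ.ι.mapIso ((CostructuredArrow.proj _ _).mapIso
      ((mkTerminalOfRightAdjoint _ T.tauMinusAdj (T.quot.obj A)).uniqueUpToIso
        (coreflectionIsTerminal hY' hY₁ hK hTK)))
  let eZ : (T.tauPlus.obj (T.quot.obj K)).obj ≅ T.quot.obj Z :=
    T.PlusQ.ι.mapIso ((StructuredArrow.proj _ _).mapIso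
      ((mkInitialOfLeftAdjoint _ T.tauPlusAdj (T.quot.obj K)).uniqueUpToIso
        (reflectionIsInitial hX' hX₁ hZ hTZ)))
  let e : T.quot.obj (T.H.obj A).obj.as ≅ T.quot.obj Z :=
    (T.tauPlus ⋙ T.PlusQ.ι).mapIso eK ≪≫ eZ
  rw [isZero_heart_iff, ← factorsW_id_iff_reflection hX' hX₁ hZ hTZ]
  exact ⟨FactorsW.id_of_iso e.symm, FactorsW.id_of_iso e⟩

end TorsionPair

open TorsionPair in
theorem mainTheorem3 {C : Type u} [Category.{v} C] [Preadditive C] [HasZeroObject C]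
    [HasShift C ℤ] [∀ n : ℤ, (shiftFunctor C n).Additive] [Pretriangulated C]
    [IsTriangulated C] (T : TorsionPair C) (A : C) :
    List.TFAE
      [IsZero (T.H.obj A),
       ∀ X : C, T.X X → ∀ x : X ⟶ A, ∃ X₀ : C, T.X X₀ ∧
         ∃ (a : X ⟶ X₀⟦(1 : ℤ)⟧) (b : X₀⟦(1 : ℤ)⟧ ⟶ A), a ≫ b = x,
       ∀ Y : C, T.Y Y → ∀ y : A ⟶ Y⟦(1 : ℤ)⟧, ∃ Y₀ : C, T.Y Y₀ ∧
         ∃ (a : A ⟶ Y₀) (b : Y₀ ⟶ Y⟦(1 : ℤ)⟧), a ≫ b = y] := by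
  obtain ⟨Y', Y₁, K, j, k, r, s, hY', hY₁, hK, hTK⟩ := exists_coreflection T A
  obtain ⟨X', X₁, Z, p, q, z, h, hX', hX₁, hZ, hTZ⟩ := exists_reflection T K
  rw [isZero_H_iff hY' hY₁ hK hTK hX' hX₁ hZ hTZ]
  tfae_have 1 → 2 := by
    intro hz X hX x
    obtain ⟨x', hx'⟩ := coyoneda_exact₃ hTK x (by
      rw [← Category.assoc, T.hom_eq_zero hX hY₁ (x ≫ r), zero_comp])
    obtain ⟨t, ht⟩ := coyoneda_exact₂ hTZ x' (hz.comp_eq_zero_of_X hX x')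
    obtain ⟨X₀, hX₀, ⟨e⟩⟩ := hX₁.exists_iso_shift
    refine ⟨X₀, hX₀, t ≫ p ≫ e.inv, e.hom ≫ q ≫ k, ?_⟩
    rw [hx', ht]
    simp
  tfae_have 2 → 1 := by
    intro h2
    obtain ⟨X₀, W₀, a, b, c, hX₀, hW₀, hT⟩ := id hK
    obtain ⟨V, hV, u, v, huv⟩ := h2 X₀ hX₀ (a ≫ k)
    obtain ⟨g, hg⟩ := (coreflection_bijective hY' hY₁ hTK
      (minus_of_XShift (XShift_shift hV))).2 (T.quot.map v)
    obtain ⟨g, rfl⟩ := T.quot.map_surjective g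
    dsimp only at hg
    rw [← Functor.map_comp, quot_map_eq_iff] at hg
    -- `g` lifts `v` only modulo `W`, but the error is invisible to `X₀ ∈ X`.
    have h3 : (u ≫ g - a) ≫ k = 0 := by
      have := hg.comp_eq_zero_of_X hX₀ u
      rw [Preadditive.comp_sub, huv] at this
      rwa [Preadditive.sub_comp, Category.assoc]
    obtain ⟨t, ht⟩ := coyoneda_exact₂ hTK (u ≫ g - a) h3
    rw [T.hom_eq_zero hX₀ hY' t, zero_comp, sub_eq_zero] at ht
    have h4 : a ≫ z = 0 := by
      rw [← ht, Category.assoc]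
      exact (Plus.factorsW hZ (XShift_shift hV) (g ≫ z)).comp_eq_zero_of_X hX₀ u
    obtain ⟨y, hy⟩ := yoneda_exact₂ hT z h4
    exact ⟨W₀, hW₀, b, y, hy.symm⟩
  tfae_have 2 → 3 := by
    intro h2 Y hY y
    obtain ⟨X₀, Y₀, f, g, c, hX₀, hY₀, hT⟩ := T.exists_triangle A
    obtain ⟨V, hV, u, v, huv⟩ := h2 X₀ hX₀ f
    obtain ⟨t, ht⟩ := yoneda_exact₂ hT y (by
      rw [← huv, Category.assoc, hom_eq_zero' (XShift_shift hV) hY (v ≫ y), comp_zero])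
    exact ⟨Y₀, hY₀, g, t, ht.symm⟩
  tfae_have 3 → 2 := by
    intro h3 X hX x
    obtain ⟨Y₀, V, f, g, c, hY₀, hV, hT⟩ := exists_triangle' (T := T) A
    obtain ⟨D, hD, u, v, huv⟩ := h3 Y₀ hY₀ c
    obtain ⟨t, ht⟩ := coyoneda_exact₃ hT x (by
      rw [← huv, ← Category.assoc, T.hom_eq_zero hX hD (x ≫ u), zero_comp])
    obtain ⟨X₀, hX₀, ⟨e⟩⟩ := hV.exists_iso_shift
    exact ⟨X₀, hX₀, t ≫ e.inv, e.hom ≫ g, by simp [ht]⟩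
  tfae_finish
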